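/- Let $\nu\ge 2$ and let $\Omega\subset\mathbb{R}^\nu$ be an open set with $C^2$ boundary $S=\partial\Omega$ and outward unit normal $n$. Let $L_s=\mathrm{d}n(s):T_sS\to T_sS$ be the shape operator, let $\kappa_1(s),\dots,\kappa_{\nu-1}(s)$ be its eigenvalues (the principal curvatures), let $K(s)=\operatorname{tr}L_s=\kappa_1(s)+\dots+\kappa_{\nu-1}(s)$, and let $K_{\max}=\sup_{s\in S}K(s)$. Assume that $\Omega$ is $C^2$-admissible, that is: (H1) there is $\delta>0$ such that $(s,t)\mapsto s-t\,n(s)$ is a diffeomorphism from $S\times(0,\delta)$ onto its image, and this image is contained in $\Omega$; (H2) the principal curvatures $\kappa_i$ are bounded on $S$. For $\alpha\in\mathbb{R}$ and $j\in\{1,2,\dots\}$ let $$E_j(-\Delta_S-\alpha K)=\inf_{\substack{L\subset H^1(S)\\ \dim L=j}}\ \max_{0\ne u\in L}\ \frac{\int_S|\nabla_S u|^2\,\mathrm{d}S-\alpha\int_S K u^2\,\mathrm{d}S}{\int_S u^2\,\mathrm{d}S}$$ be the $j$-th Rayleigh quotient of the operator $-\Delta_S-\alpha K$ in the real space $L^2(S,\mathrm{d}S)$,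 where $-\Delta_S$ is the positive Laplace--Beltrami operator on $S$. If the set $\{s\in S: K(s)=K_{\max}\}$ has non-empty interior in $S$, then for each fixed $j\ge 1$ $$E_j(-\Delta_S-\alpha K)=-\alpha K_{\max}+\mathcal{O}(1)\qquad\text{as }\alpha\to+\infty.$$ -/

import Mathlib

open MeasureTheory Set Filter Topology
open scoped RealInnerProductSpace

noncomputable section

namespace RobinBoundary

/-- `ρ` is a `C²` defining function of `Ω` on the open set `U`: it has no critical point in `U`,
and `Ω` is the sublevel set `{ρ < 0}` in `U`. -/
structure IsDefiningFunction {ν : ℕ} (Ω U : Set (EuclideanSpace ℝ (Fin ν)))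
    (ρ : EuclideanSpace ℝ (Fin ν) → ℝ) : Prop where
  isOpen : IsOpen U
  contDiffOn : ContDiffOn ℝ 2 ρ U
  gradient_ne_zero : ∀ x ∈ U, gradient ρ x ≠ 0
  inter_eq : Ω ∩ U = {x ∈ U | ρ x < 0}

/-- `Ω` has a `C²` boundary. -/
def HasC2Boundary {ν : ℕ} (Ω : Set (EuclideanSpace ℝ (Fin ν))) : Prop :=
  ∀ s ∈ frontier Ω, ∃ U ρ, s ∈ U ∧ IsDefiningFunction Ω U ρ

/-- `v` is the outward pointing unit normal of `∂Ω` at `s`: the normalized gradient of a local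
defining function. -/
def IsOutwardNormal {ν : ℕ} (Ω : Set (EuclideanSpace ℝ (Fin ν)))
    (s v : EuclideanSpace ℝ (Fin ν)) : Prop :=
  ∃ U ρ, s ∈ U ∧ IsDefiningFunction Ω U ρ ∧ v = ‖gradient ρ s‖⁻¹ • gradient ρ s

/-- The Gauss map `s ↦ n(s)`, used on `∂Ω` only. -/
def normal {ν : ℕ} (Ω : Set (EuclideanSpace ℝ (Fin ν))) (s : EuclideanSpace ℝ (Fin ν)) :
    EuclideanSpace ℝ (Fin ν) :=
  Classical.epsilon (IsOutwardNormal Ω s)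

/-- The tangent space `T_s S` of `S = ∂Ω`. -/
abbrev tangent {ν : ℕ} (Ω : Set (EuclideanSpace ℝ (Fin ν))) (s : EuclideanSpace ℝ (Fin ν)) :
    Submodule ℝ (EuclideanSpace ℝ (Fin ν)) :=
  (Submodule.span ℝ {normal Ω s})ᗮ

/-- The shape operator `L_s = dn(s) : T_s S → T_s S`. The derivative of `n` within `S` is determined
on tangent vectors, to which it is restricted here; its values there are tangent, so that the
orthogonal projection only serves to restrict the codomain. -/
def shapeOperator {ν : ℕ} (Ω : Set (EuclideanSpace ℝ (Fin ν))) (s : EuclideanSpace ℝ (Fin ν)) :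
    tangent Ω s →L[ℝ] tangent Ω s :=
  (tangent Ω s).orthogonalProjectionOnto ∘L fderivWithin ℝ (normal Ω) (frontier Ω) s ∘L
    (tangent Ω s).subtypeL

/-- `K(s) = tr L_s`, the sum of the principal curvatures. -/
def curvature {ν : ℕ} (Ω : Set (EuclideanSpace ℝ (Fin ν))) (s : EuclideanSpace ℝ (Fin ν)) : ℝ :=
  LinearMap.trace ℝ (tangent Ω s) (shapeOperator Ω s).toLinearMap

/-- `K_max = sup_S K`. -/
def curvatureMax {ν : ℕ} (Ω : Set (EuclideanSpace ℝ (Fin ν))) : ℝ :=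
  sSup (curvature Ω '' frontier Ω)

/-- `C²`-admissible open sets. -/
structure IsC2Admissible {ν : ℕ} (Ω : Set (EuclideanSpace ℝ (Fin ν))) : Prop where
  isOpen : IsOpen Ω
  boundary : HasC2Boundary Ω
  /-- The map `Φ(s,t) = s - t n(s)` is a diffeomorphism of `S × (0,δ)` onto its image, and the image
  lies in `Ω`. The differential of `Φ` at `(s,t)` is `(v,τ) ↦ (I - t L_s) v - τ n(s)`, so it is
  invertible exactly if `I - t L_s` is injective on `T_s S`. -/
  nonoverlap : ∃ δ : ℝ, 0 < δ ∧
    InjOn (fun p : EuclideanSpace ℝ (Fin ν) × ℝ => p.1 - p.2 • normal Ω p.1)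
      (frontier Ω ×ˢ Ioo 0 δ) ∧
    ∀ s ∈ frontier Ω, ∀ t ∈ Ioo 0 δ, s - t • normal Ω s ∈ Ω ∧
      Function.Injective fun v : tangent Ω s => v - t • shapeOperator Ω s v
  /-- The principal curvatures are bounded. -/
  curvature_bounded : ∃ M : ℝ, ∀ s ∈ frontier Ω, ∀ κ : ℝ,
    Module.End.HasEigenvalue (shapeOperator Ω s).toLinearMap κ → |κ| ≤ M

/-- The surface measure `dS` on `S = ∂Ω`, as a measure on `ℝ^ν` carried by `S`: the
`(ν-1)`-dimensional Hausdorff measure, normalized as the Riemannian surface area. -/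
def surfaceMeasure {ν : ℕ} (Ω : Set (EuclideanSpace ℝ (Fin ν))) :
    Measure (EuclideanSpace ℝ (Fin ν)) :=
  (Measure.euclideanHausdorffMeasure (ν - 1)).restrict (frontier Ω)

/-- The real Hilbert space `L²(S, dS)`. -/
abbrev L2 {ν : ℕ} (Ω : Set (EuclideanSpace ℝ (Fin ν))) : Type :=
  Lp ℝ 2 (surfaceMeasure Ω)

/-- Square integrable fields of vectors of `ℝ^ν` on `S`. -/
abbrev L2Field {ν : ℕ} (Ω : Set (EuclideanSpace ℝ (Fin ν))) : Type :=
  Lp (EuclideanSpace ℝ (Fin ν)) 2 (surfaceMeasure Ω)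

/-- `ψ : U → S` is a `C²` local parametrization of `S = ∂Ω`: an injective immersion of an open
subset `U` of `ℝ^(ν-1)`. As `S` has dimension `ν - 1`, it is a diffeomorphism onto an open
subset of `S`. -/
structure IsLocalParam {ν : ℕ} (Ω : Set (EuclideanSpace ℝ (Fin ν)))
    (U : Set (EuclideanSpace ℝ (Fin (ν - 1))))
    (ψ : EuclideanSpace ℝ (Fin (ν - 1)) → EuclideanSpace ℝ (Fin ν)) : Prop where
  isOpen : IsOpen U
  contDiffOn : ContDiffOn ℝ 2 ψ U
  injOn : InjOn ψ U
  mapsTo : MapsTo ψ U (frontier Ω)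
  immersion : ∀ x ∈ U, Function.Injective (fderiv ℝ ψ x)

/-- `G` is the weak gradient `∇_S u`: it is tangent to `S`, and in every local parametrization `ψ`
one has `∂_e (u ∘ ψ) = ⟨G ∘ ψ, ∂_e ψ⟩` in the sense of distributions, for all directions `e`.
In coordinates this is `|G|² = g^{ρμ} ∂_ρ u ∂_μ u`. -/
def IsWeakGradient {ν : ℕ} (Ω : Set (EuclideanSpace ℝ (Fin ν))) (u : L2 Ω) (G : L2Field Ω) :
    Prop :=
  (∀ᵐ s ∂(surfaceMeasure Ω), G s ∈ tangent Ω s) ∧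
  ∀ U ψ, IsLocalParam Ω U ψ →
    ∀ η : EuclideanSpace ℝ (Fin (ν - 1)) → ℝ, ContDiff ℝ (⊤ : ℕ∞) η → HasCompactSupport η →
      tsupport η ⊆ U → ∀ e : EuclideanSpace ℝ (Fin (ν - 1)),
        ∫ x, u (ψ x) * fderiv ℝ η x e = - ∫ x, ⟪G (ψ x), fderiv ℝ ψ x e⟫ * η x

/-- The Sobolev space `H¹(S)`. -/
def sobolev {ν : ℕ} (Ω : Set (EuclideanSpace ℝ (Fin ν))) : Set (L2 Ω) :=
  {u | ∃ G : L2Field Ω, IsWeakGradient Ω u G}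

/-- The Dirichlet integral `∫_S |∇_S u|² dS` of `u ∈ H¹(S)`. The weak gradient of `u` is unique as
an element of `L²`, so the infimum is over a single number. -/
def dirichlet {ν : ℕ} (Ω : Set (EuclideanSpace ℝ (Fin ν))) (u : L2 Ω) : ℝ :=
  sInf {r | ∃ G : L2Field Ω, IsWeakGradient Ω u G ∧ r = ∫ s, ‖G s‖ ^ 2 ∂(surfaceMeasure Ω)}

/-- The quadratic form of `-Δ_S - α K`, with form domain `H¹(S)`. -/
def form {ν : ℕ} (Ω : Set (EuclideanSpace ℝ (Fin ν))) (α : ℝ) (u : L2 Ω) : ℝ :=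
  dirichlet Ω u - α * ∫ s, curvature Ω s * u s ^ 2 ∂(surfaceMeasure Ω)

/-- The `j`-th Rayleigh quotient `E_j(-Δ_S - α K)`, `j ≥ 1`, as an extended real number: the infimum
over the `j`-dimensional subspaces `L` of the form domain of the maximum of `q(u,u) / ⟨u,u⟩`
over nonzero `u ∈ L`. -/
def rayleigh {ν : ℕ} (Ω : Set (EuclideanSpace ℝ (Fin ν))) (α : ℝ) (j : ℕ) : EReal :=
  ⨅ (L : Submodule ℝ (L2 Ω)) (_ : (L : Set (L2 Ω)) ⊆ sobolev Ω) (_ : Module.finrank ℝ L = j),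
    ⨆ (u : L2 Ω) (_ : u ∈ L) (_ : u ≠ 0), ((form Ω α u / ‖u‖ ^ 2 : ℝ) : EReal)

end RobinBoundary

end

/-!
For `α ≥ 0` the potential `-αK` is bounded below by `-α K_max`, and it equals this number on an
open piece of the boundary `S`.

*Lower bound.* The Dirichlet integral is nonnegative and `∫ K u² ≤ K_max ‖u‖²`, so every Rayleigh
quotient is at least `-α K_max` (`le_rayleigh`). This requires `K` to be bounded and measurable,
so that neither `K_max` nor the integral takes a junk value. Near a boundary point the normal is
the normalized gradient `N` of a defining function (`normal_eq`), and the derivative of the normal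
within `S` agrees with `dN` on tangent vectors, since these lie in the tangent cone of `S`
(`fderivWithin_normal_eq`). Hence `K = tr dN - ⟨N, dN N⟩` is continuous
(`continuousOn_curvature`), and the shape operator inherits symmetry from the Hessian, so that `K`
is the sum of the principal curvatures, which are bounded (`exists_abs_curvature_le`).

*Upper bound.* Take `j` bumps with disjoint supports in a small ball around a point of `S` near
which `K = K_max`, and restrict them to `S`. On their span the potential acts as the number
`-α K_max`, and the Dirichlet integral is at most `C ‖u‖²` with `C` independent of `α`
(`exists_rayleigh_le`). Three facts about `S` enter. Its area in a small ball is finite, as the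
orthogonal projection to the tangent plane has a Lipschitz inverse on `S` near the point of
contact (`exists_surfaceMeasure_ball_lt_top`). That area is positive, as the same projection
covers a neighbourhood: small segments normal to the tangent plane lead out of `Ω` and so meet `S`
(`surfaceMeasure_ball_pos`). Finally, the restriction of a `C¹` function has the tangential part
of its gradient as weak gradient (`isWeakGradient_toLp`), by integration by parts in a
parametrization, where exceptional null sets may be neglected because an immersion is locally
bi-Lipschitz (`IsLocalParam.ae_comp`).
-/

noncomputable section

namespace RobinBoundary

open scoped NNReal ENNReal

variable {ν : ℕ} {Ω U : Set (EuclideanSpace ℝ (Fin ν))} {ρ : EuclideanSpace ℝ (Fin ν) → ℝ}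
  {s : EuclideanSpace ℝ (Fin ν)}

/-! ### Defining functions and the outward normal -/

/-- The normalized gradient of `ρ`, which extends the outward normal off the zero set of `ρ`. -/
def unitGradient {ν : ℕ} (ρ : EuclideanSpace ℝ (Fin ν) → ℝ) (x : EuclideanSpace ℝ (Fin ν)) :
    EuclideanSpace ℝ (Fin ν) :=
  ‖gradient ρ x‖⁻¹ • gradient ρ x

/-- A segment from a point of `A` to a point outside `A` meets `frontier A`. -/
lemma exists_mem_segment_mem_frontier {V : Type*} [NormedAddCommGroup V] [NormedSpace ℝ V]
    {A : Set V} {a b : V} (ha : a ∈ A) (hb : b ∉ A) : ∃ c ∈ segment ℝ a b, c ∈ frontier A := by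
  by_contra! h
  have hpre : IsPreconnected (segment ℝ a b) := (convex_segment a b).isPreconnected
  have key := hpre (interior A) (closure A)ᶜ isOpen_interior isClosed_closure.isOpen_compl
    (fun x hx => by
      by_cases hxc : x ∈ closure A
      · exact Or.inl (by_contra fun hxi => h x hx ⟨hxc, hxi⟩)
      · exact Or.inr hxc)
    ⟨a, left_mem_segment ℝ a b, by_contra fun hi => h a (left_mem_segment ℝ a b)
      ⟨subset_closure ha, hi⟩⟩
    ⟨b, right_mem_segment ℝ a b, fun hc => h b (right_mem_segment ℝ a b)
      ⟨hc, fun hi => hb (interior_subset hi)⟩⟩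
  obtain ⟨x, -, hx1, hx2⟩ := key
  exact hx2 (subset_closure (interior_subset hx1))

namespace IsDefiningFunction

lemma eventually_mem (h : IsDefiningFunction Ω U ρ) (hs : s ∈ U) : ∀ᶠ x in 𝓝 s, x ∈ U :=
  h.isOpen.mem_nhds hs

lemma contDiffAt (h : IsDefiningFunction Ω U ρ) (hs : s ∈ U) : ContDiffAt ℝ 2 ρ s :=
  h.contDiffOn.contDiffAt (h.eventually_mem hs)

lemma mem_iff (h : IsDefiningFunction Ω U ρ) (hs : s ∈ U) : s ∈ Ω ↔ ρ s < 0 := by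
  have := Set.ext_iff.1 h.inter_eq s
  simpa [hs] using this

lemma eq_zero_of_mem_frontier (h : IsDefiningFunction Ω U ρ) (hΩ : IsOpen Ω) (hs : s ∈ U)
    (hf : s ∈ frontier Ω) : ρ s = 0 := by
  apply le_antisymm
  · by_contra! hpos
    have h1 : ∀ᶠ x in 𝓝 s, x ∈ U ∧ 0 < ρ x :=
      (h.eventually_mem hs).and ((h.contDiffAt hs).continuousAt.eventually (lt_mem_nhds hpos))
    obtain ⟨x, hxΩ, hxU, hx⟩ :=
      ((mem_closure_iff_frequently.1 (frontier_subset_closure hf)).and_eventually h1).exists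
    exact lt_asymm hx ((h.mem_iff hxU).1 hxΩ)
  · rw [hΩ.frontier_eq] at hf
    exact not_lt.1 fun hlt => hf.2 ((h.mem_iff hs).2 hlt)

lemma norm_unitGradient (h : IsDefiningFunction Ω U ρ) (hs : s ∈ U) : ‖unitGradient ρ s‖ = 1 := by
  have := h.gradient_ne_zero s hs
  simp [unitGradient, norm_smul, this]

lemma hasStrictFDerivAt (h : IsDefiningFunction Ω U ρ) (hs : s ∈ U) :
    HasStrictFDerivAt ρ (‖gradient ρ s‖ • innerSL ℝ (unitGradient ρ s)) s := by
  have h1 := (h.contDiffAt hs).hasStrictFDerivAt (by norm_num)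
  have := norm_ne_zero_iff.2 (h.gradient_ne_zero s hs)
  suffices h2 : ‖gradient ρ s‖ • innerSL ℝ (unitGradient ρ s) = fderiv ℝ ρ s by rwa [h2]
  refine ContinuousLinearMap.ext fun v => ?_
  rw [smul_apply, innerSL_apply_apply, unitGradient, real_inner_smul_left, smul_eq_mul,
    mul_inv_cancel_left₀ this]
  exact InnerProductSpace.toDual_symm_apply

lemma norm_gradient_pos (h : IsDefiningFunction Ω U ρ) (hs : s ∈ U) : 0 < ‖gradient ρ s‖ :=
  norm_pos_iff.2 (h.gradient_ne_zero s hs)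

lemma tendsto_inv_mul_line (h : IsDefiningFunction Ω U ρ) (hs : s ∈ U) (h0 : ρ s = 0)
    (v : EuclideanSpace ℝ (Fin ν)) :
    Tendsto (fun t : ℝ => t⁻¹ * ρ (s + t • v)) (𝓝[>] 0)
      (𝓝 (‖gradient ρ s‖ * ⟪unitGradient ρ s, v⟫)) := by
  have h1 : HasDerivAt (fun t : ℝ => s + t • v) v 0 := by
    simpa using ((hasDerivAt_id (0 : ℝ)).smul_const v).const_add s
  have h2 : HasFDerivAt ρ (‖gradient ρ s‖ • innerSL ℝ (unitGradient ρ s)) (s + (0 : ℝ) • v) := by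
    simpa using (h.hasStrictFDerivAt hs).hasFDerivAt
  have h3 := (hasDerivAt_iff_tendsto_slope.1 (h2.comp_hasDerivAt (0 : ℝ) h1)).mono_left
    (nhdsWithin_mono (0 : ℝ) (fun x (hx : x ∈ Ioi (0 : ℝ)) => ne_of_gt hx))
  simpa [slope_fun_def, h0, Function.comp_def] using h3

lemma eventually_line_mem (h : IsDefiningFunction Ω U ρ) (hs : s ∈ U)
    (v : EuclideanSpace ℝ (Fin ν)) : ∀ᶠ t in 𝓝[>] (0 : ℝ), s + t • v ∈ U := by
  have hc : ContinuousAt (fun t : ℝ => s + t • v) 0 := by fun_prop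
  exact (hc.eventually (by simpa using h.eventually_mem hs)).filter_mono nhdsWithin_le_nhds

lemma eventually_mem_of_inner_neg (h : IsDefiningFunction Ω U ρ) (hs : s ∈ U) (h0 : ρ s = 0)
    {v : EuclideanSpace ℝ (Fin ν)} (hv : ⟪unitGradient ρ s, v⟫ < 0) :
    ∀ᶠ t in 𝓝[>] (0 : ℝ), s + t • v ∈ Ω := by
  have hneg := mul_neg_of_pos_of_neg (h.norm_gradient_pos hs) hv
  filter_upwards [h.eventually_line_mem hs v,
    (h.tendsto_inv_mul_line hs h0 v).eventually (gt_mem_nhds hneg), self_mem_nhdsWithin]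
    with t htU ht ht0
  rw [h.mem_iff htU]
  by_contra! hge
  exact absurd ht (not_lt.2 (mul_nonneg (inv_nonneg.2 (le_of_lt ht0)) hge))

lemma eventually_notMem_of_inner_pos (h : IsDefiningFunction Ω U ρ) (hs : s ∈ U) (h0 : ρ s = 0)
    {v : EuclideanSpace ℝ (Fin ν)} (hv : 0 < ⟪unitGradient ρ s, v⟫) :
    ∀ᶠ t in 𝓝[>] (0 : ℝ), s + t • v ∉ Ω := by
  have hpos := mul_pos (h.norm_gradient_pos hs) hv
  filter_upwards [h.eventually_line_mem hs v,
    (h.tendsto_inv_mul_line hs h0 v).eventually (lt_mem_nhds hpos), self_mem_nhdsWithin]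
    with t htU ht ht0
  rw [h.mem_iff htU]
  exact fun hlt => absurd ht
    (not_lt.2 (mul_nonpos_of_nonneg_of_nonpos (inv_nonneg.2 (le_of_lt ht0)) hlt.le))

/-- Two defining functions have the same normalized gradient at a common zero: otherwise moving
along the difference of the normals would lead into `Ω` for one and out of it for the other. -/
lemma unitGradient_eq {U' : Set (EuclideanSpace ℝ (Fin ν))} {ρ' : EuclideanSpace ℝ (Fin ν) → ℝ}
    (h : IsDefiningFunction Ω U ρ) (h' : IsDefiningFunction Ω U' ρ') (hΩ : IsOpen Ω)
    (hs : s ∈ U) (hs' : s ∈ U') (hf : s ∈ frontier Ω) :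
    unitGradient ρ s = unitGradient ρ' s := by
  by_contra hne
  have hn := h.norm_unitGradient hs
  have hn' := h'.norm_unitGradient hs'
  have hlt : ⟪unitGradient ρ s, unitGradient ρ' s⟫ < 1 :=
    (inner_lt_one_iff_real_of_norm_eq_one hn hn').2 hne
  have h1 : ⟪unitGradient ρ s, unitGradient ρ' s - unitGradient ρ s⟫ < 0 := by
    rw [inner_sub_right, real_inner_self_eq_norm_sq, hn]; linarith
  have h2 : 0 < ⟪unitGradient ρ' s, unitGradient ρ' s - unitGradient ρ s⟫ := by
    rw [inner_sub_right, real_inner_self_eq_norm_sq, hn', real_inner_comm]; linarith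
  obtain ⟨t, ht, ht'⟩ :=
    ((h.eventually_mem_of_inner_neg hs (h.eq_zero_of_mem_frontier hΩ hs hf) h1).and
      (h'.eventually_notMem_of_inner_pos hs' (h'.eq_zero_of_mem_frontier hΩ hs' hf) h2)).exists
  exact ht' ht

lemma normal_eq (h : IsDefiningFunction Ω U ρ) (hΩ : IsOpen Ω) (hs : s ∈ U)
    (hf : s ∈ frontier Ω) : normal Ω s = unitGradient ρ s := by
  have hex : ∃ v, IsOutwardNormal Ω s v := ⟨_, U, ρ, hs, h, rfl⟩
  obtain ⟨U', ρ', hs', h', he⟩ := Classical.epsilon_spec hex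
  exact he.trans (h'.unitGradient_eq h hΩ hs' hs hf)

end IsDefiningFunction

lemma norm_normal (hΩ : IsC2Admissible Ω) (hf : s ∈ frontier Ω) : ‖normal Ω s‖ = 1 := by
  obtain ⟨U, ρ, hs, h⟩ := hΩ.boundary s hf
  rw [h.normal_eq hΩ.isOpen hs hf, h.norm_unitGradient hs]

/-- Near a point `s` of the boundary, the boundary is flat to first order: its chords are almost
orthogonal to `n(s)`. -/
lemma exists_abs_inner_normal_le (hΩ : IsC2Admissible Ω) (hf : s ∈ frontier Ω) {ε : ℝ}
    (hε : 0 < ε) : ∃ r > 0, ∀ x ∈ frontier Ω ∩ Metric.ball s r, ∀ y ∈ frontier Ω ∩ Metric.ball s r,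
      |⟪normal Ω s, x - y⟫| ≤ ε * ‖x - y‖ := by
  obtain ⟨U, ρ, hs, h⟩ := hΩ.boundary s hf
  have hg := h.norm_gradient_pos hs
  have h1 := (h.hasStrictFDerivAt hs).isLittleO.def (mul_pos hg hε)
  rw [nhds_prod_eq] at h1
  obtain ⟨V, hV, hVs⟩ := Filter.eventually_prod_self_iff 
    (r := fun x y => ‖ρ x - ρ y - (‖gradient ρ s‖ • innerSL ℝ (unitGradient ρ s)) (x - y)‖ ≤
      ‖gradient ρ s‖ * ε * ‖x - y‖) |>.1 h1
  obtain ⟨r, hr, hrV⟩ := Metric.mem_nhds_iff.1 (inter_mem hV (h.eventually_mem hs))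
  refine ⟨r, hr, fun x hx y hy => ?_⟩
  have h2 := hVs x (hrV hx.2).1 y (hrV hy.2).1
  rw [h.eq_zero_of_mem_frontier hΩ.isOpen (hrV hx.2).2 hx.1,
    h.eq_zero_of_mem_frontier hΩ.isOpen (hrV hy.2).2 hy.1] at h2
  simp only [sub_zero, zero_sub, norm_neg, smul_apply, innerSL_apply_apply,
    smul_eq_mul, norm_mul, Real.norm_eq_abs] at h2
  rw [h.normal_eq hΩ.isOpen hs hf]
  rw [mul_assoc, abs_of_pos hg] at h2
  exact le_of_mul_le_mul_left h2 hg

/-- Over each small tangent vector `v` at `s` there is a point of the boundary, at a distance from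
the tangent plane that is small compared with `‖v‖`. -/
lemma exists_add_smul_normal_mem_frontier (hΩ : IsC2Admissible Ω) (hf : s ∈ frontier Ω) {ε : ℝ}
    (hε : 0 < ε) : ∃ r > 0, ∀ v, ⟪normal Ω s, v⟫ = 0 → ‖v‖ < r →
      ∃ τ : ℝ, |τ| ≤ ε * ‖v‖ ∧ s + (v + τ • normal Ω s) ∈ frontier Ω := by
  obtain ⟨U, ρ, hs, h⟩ := hΩ.boundary s hf
  have hg := h.norm_gradient_pos hs
  have hn := norm_normal hΩ hf
  -- At the points `v ± ε ‖v‖ n`, of norm at most `(1 + ε) ‖v‖`, the linear part of `ρ` is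
  -- `± ε ‖v‖ ‖∇ρ‖`; this bound on the remainder keeps the sign of `ρ`.
  have hc : 0 < ‖gradient ρ s‖ * ε / (2 * (1 + ε)) := by positivity
  have h1 := (hasFDerivAt_iff_isLittleO_nhds_zero.1 (h.hasStrictFDerivAt hs).hasFDerivAt).def hc
  have hU : ∀ᶠ w in 𝓝 (0 : EuclideanSpace ℝ (Fin ν)), s + w ∈ U := by
    have hc : ContinuousAt (fun w : EuclideanSpace ℝ (Fin ν) => s + w) 0 := by fun_prop
    exact hc.eventually (by simpa using h.eventually_mem hs)
  obtain ⟨r, hr, hball⟩ := Metric.eventually_nhds_iff_ball.1 (h1.and hU)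
  rw [← h.normal_eq hΩ.isOpen hs hf, h.eq_zero_of_mem_frontier hΩ.isOpen hs hf] at hball
  refine ⟨r / (1 + ε), by positivity, fun v hv hvr => ?_⟩
  rcases eq_or_ne v 0 with rfl | hv0
  · exact ⟨0, by simp, by simpa using hf⟩
  have hvpos := norm_pos_iff.2 hv0
  have hw : ∀ σ : ℝ, |σ| = ε * ‖v‖ → s + (v + σ • normal Ω s) ∈ U ∧
      |ρ (s + (v + σ • normal Ω s)) - ‖gradient ρ s‖ * σ| ≤ ‖gradient ρ s‖ * (ε * ‖v‖) / 2 := by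
    intro σ hσ
    have hle : ‖v + σ • normal Ω s‖ ≤ (1 + ε) * ‖v‖ := by
      refine (norm_add_le _ _).trans ?_
      rw [norm_smul, hn, Real.norm_eq_abs, hσ]; linarith
    have hmem : v + σ • normal Ω s ∈ Metric.ball 0 r := by
      rw [mem_ball_zero_iff]
      refine hle.trans_lt ?_
      rw [lt_div_iff₀ (by positivity)] at hvr
      linarith
    obtain ⟨ha, hb⟩ := hball _ hmem
    refine ⟨hb, ?_⟩
    simp only [sub_zero, smul_apply, innerSL_apply_apply, inner_add_right, hv,
      inner_smul_right, real_inner_self_eq_norm_sq, hn, smul_eq_mul, Real.norm_eq_abs] at ha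
    simp only [one_pow, mul_one, zero_add] at ha
    refine ha.trans ?_
    calc ‖gradient ρ s‖ * ε / (2 * (1 + ε)) * ‖v + σ • normal Ω s‖
        ≤ ‖gradient ρ s‖ * ε / (2 * (1 + ε)) * ((1 + ε) * ‖v‖) := by gcongr
      _ = ‖gradient ρ s‖ * (ε * ‖v‖) / 2 := by field_simp
  have hpos : 0 < ‖gradient ρ s‖ * (ε * ‖v‖) := by positivity
  obtain ⟨hp1, hp2⟩ := hw (ε * ‖v‖) (abs_of_pos (by positivity))
  obtain ⟨hm1, hm2⟩ := hw (-(ε * ‖v‖)) (by rw [abs_neg]; exact abs_of_pos (by positivity))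
  rw [abs_le] at hp2 hm2
  have hin : s + (v + (-(ε * ‖v‖)) • normal Ω s) ∈ Ω := (h.mem_iff hm1).2 (by linarith)
  have hout : s + (v + (ε * ‖v‖) • normal Ω s) ∉ Ω := fun hc => by
    have := (h.mem_iff hp1).1 hc
    linarith
  obtain ⟨c, hc, hcf⟩ := exists_mem_segment_mem_frontier hin hout
  obtain ⟨a, b, ha, hb, hab, rfl⟩ := hc
  refine ⟨(b - a) * (ε * ‖v‖), ?_, ?_⟩
  · rw [abs_mul, abs_of_pos (mul_pos hε hvpos)]
    have : |b - a| ≤ 1 := abs_le.2 ⟨by linarith, by linarith⟩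
    nlinarith [mul_pos hε hvpos]
  · convert hcf using 1
    obtain rfl : a = 1 - b := by linarith
    module

/-! ### Tangent vectors and the curvature -/

lemma mem_tangent_iff {v : EuclideanSpace ℝ (Fin ν)} : v ∈ tangent Ω s ↔ ⟪normal Ω s, v⟫ = 0 :=
  Submodule.mem_orthogonal_singleton_iff_inner_right

/-- Tangent vectors are limits of rescaled chords of the boundary. -/
lemma mem_tangentConeAt_frontier (hΩ : IsC2Admissible Ω) (hf : s ∈ frontier Ω)
    {v : EuclideanSpace ℝ (Fin ν)} (hv : v ∈ tangent Ω s) :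
    v ∈ tangentConeAt ℝ (frontier Ω) s := by
  rw [mem_tangent_iff] at hv
  have hn := norm_normal hΩ hf
  -- The `k`-th chord is a short step `t v` corrected by `τ n`, where `|τ| ≤ ‖t v‖ / (k + 1)`.
  have key : ∀ k : ℕ, ∃ t τ : ℝ, 0 < t ∧ t ≤ ((k : ℝ) + 1)⁻¹ ∧ |τ| ≤ ((k : ℝ) + 1)⁻¹ * ‖t • v‖ ∧
      s + (t • v + τ • normal Ω s) ∈ frontier Ω := by
    intro k
    obtain ⟨r, hr, h⟩ := exists_add_smul_normal_mem_frontier hΩ hf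
      (show 0 < ((k : ℝ) + 1)⁻¹ by positivity)
    have ht : 0 < min ((k : ℝ) + 1)⁻¹ (r / (‖v‖ + 1)) := by positivity
    obtain ⟨τ, h1, h2⟩ := h (min ((k : ℝ) + 1)⁻¹ (r / (‖v‖ + 1)) • v)
      (by rw [inner_smul_right, hv, mul_zero]) (by
        rw [norm_smul, Real.norm_eq_abs, abs_of_pos ht]
        calc _ ≤ r / (‖v‖ + 1) * ‖v‖ := by gcongr; exact min_le_right _ _
          _ < r / (‖v‖ + 1) * (‖v‖ + 1) := by gcongr; linarith
          _ = r := by field_simp)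
    exact ⟨_, τ, ht, min_le_left _ _, h1, h2⟩
  choose t τ ht0 ht hτ hmem using key
  have hlim : Tendsto (fun k : ℕ => ((k : ℝ) + 1)⁻¹) atTop (𝓝 0) := by
    simpa using tendsto_one_div_add_atTop_nhds_zero_nat (𝕜 := ℝ)
  have htlim : Tendsto t atTop (𝓝 0) :=
    squeeze_zero (fun k => (ht0 k).le) ht hlim
  have hq : Tendsto (fun k => (t k)⁻¹ * τ k) atTop (𝓝 0) := by
    refine squeeze_zero_norm (a := fun k : ℕ => ((k : ℝ) + 1)⁻¹ * ‖v‖) (fun k => ?_)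
      (by simpa using hlim.mul_const ‖v‖)
    rw [norm_mul, Real.norm_eq_abs, abs_inv, abs_of_pos (ht0 k), Real.norm_eq_abs]
    have := hτ k
    rw [norm_smul, Real.norm_eq_abs, abs_of_pos (ht0 k)] at this
    rw [inv_mul_le_iff₀ (ht0 k)]
    linarith
  have hcd : Tendsto (fun k => (t k)⁻¹ • (t k • v + τ k • normal Ω s)) atTop (𝓝 v) := by
    have h1 : Tendsto (fun k => v + ((t k)⁻¹ * τ k) • normal Ω s) atTop (𝓝 v) := by
      simpa using (hq.smul_const (normal Ω s)).const_add v
    refine h1.congr fun k => ?_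
    rw [smul_add, smul_smul, smul_smul, inv_mul_cancel₀ (ht0 k).ne', one_smul]
  refine mem_tangentConeAt_of_seq atTop (fun k => (t k)⁻¹)
    (fun k => t k • v + τ k • normal Ω s) ?_ (Eventually.of_forall hmem) hcd
  have h2 := htlim.smul hcd
  rw [zero_smul] at h2
  refine h2.congr fun k => ?_
  rw [smul_smul, mul_inv_cancel₀ (ht0 k).ne', one_smul]

namespace IsDefiningFunction

lemma contDiffAt_gradient (h : IsDefiningFunction Ω U ρ) (hs : s ∈ U) :
    ContDiffAt ℝ 1 (gradient ρ) s := by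
  have h1 : ContDiffAt ℝ 1 (fderiv ℝ ρ) s := (h.contDiffAt hs).fderiv_right (by norm_num)
  exact (InnerProductSpace.toDual ℝ
    (EuclideanSpace ℝ (Fin ν))).symm.toContinuousLinearEquiv.contDiff.contDiffAt.comp s h1

lemma contDiffAt_unitGradient (h : IsDefiningFunction Ω U ρ) (hs : s ∈ U) :
    ContDiffAt ℝ 1 (unitGradient ρ) s :=
  ((((h.contDiffAt_gradient hs).norm ℝ (h.gradient_ne_zero s hs))).inv
    (h.norm_gradient_pos hs).ne').smul (h.contDiffAt_gradient hs)

/-- The derivative of the normalized gradient is, up to a positive factor and modulo the normal, the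
Hessian; so it is symmetric on vectors orthogonal to the gradient. -/
lemma inner_fderiv_unitGradient_comm (h : IsDefiningFunction Ω U ρ) (hs : s ∈ U)
    {v w : EuclideanSpace ℝ (Fin ν)} (hv : ⟪unitGradient ρ s, v⟫ = 0)
    (hw : ⟪unitGradient ρ s, w⟫ = 0) :
    ⟪fderiv ℝ (unitGradient ρ) s v, w⟫ = ⟪fderiv ℝ (unitGradient ρ) s w, v⟫ := by
  have hg := h.norm_gradient_pos hs
  have hort : ∀ z, ⟪unitGradient ρ s, z⟫ = 0 → ⟪gradient ρ s, z⟫ = 0 := by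
    intro z hz
    rw [unitGradient, real_inner_smul_left] at hz
    exact (mul_eq_zero.1 hz).resolve_left (inv_ne_zero hg.ne')
  have hgd : DifferentiableAt ℝ (gradient ρ) s :=
    (h.contDiffAt_gradient hs).differentiableAt one_ne_zero
  have hnd : DifferentiableAt ℝ (fun x => ‖gradient ρ x‖⁻¹) s :=
    ((((h.contDiffAt_gradient hs).norm ℝ (h.gradient_ne_zero s hs))).inv hg.ne').differentiableAt
      one_ne_zero
  have hfd : DifferentiableAt ℝ (fderiv ℝ ρ) s :=
    ((h.contDiffAt hs).fderiv_right (m := 1) (by norm_num)).differentiableAt one_ne_zero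
  have hgrad : ∀ z y, ⟪fderiv ℝ (gradient ρ) s z, y⟫ = fderiv ℝ (fderiv ℝ ρ) s z y := by
    intro z y
    have h1 : HasFDerivAt (gradient ρ) ((InnerProductSpace.toDual ℝ
      (EuclideanSpace ℝ (Fin ν))).symm.toContinuousLinearEquiv.toContinuousLinearMap.comp
        (fderiv ℝ (fderiv ℝ ρ) s)) s :=
      (InnerProductSpace.toDual ℝ
        (EuclideanSpace ℝ (Fin ν))).symm.toContinuousLinearEquiv.hasFDerivAt.comp s hfd.hasFDerivAt
    rw [h1.fderiv]
    exact InnerProductSpace.toDual_symm_apply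
  have hunit : ∀ z y, ⟪gradient ρ s, y⟫ = 0 → ⟪fderiv ℝ (unitGradient ρ) s z, y⟫ =
      ‖gradient ρ s‖⁻¹ * fderiv ℝ (fderiv ℝ ρ) s z y := by
    intro z y hy
    have h1 := hnd.hasFDerivAt.fun_smul hgd.hasFDerivAt
    have h2 : fderiv ℝ (unitGradient ρ) s = _ := h1.fderiv
    rw [h2]
    simp only [add_apply, smul_apply, ContinuousLinearMap.smulRight_apply, inner_add_left,
      real_inner_smul_left, hy, mul_zero, add_zero, hgrad]
  rw [hunit v w (hort w hw), hunit w v (hort v hv)]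
  congr 1
  exact ((h.contDiffAt hs).isSymmSndFDerivAt (by simp)) v w

lemma fderivWithin_normal_eq (h : IsDefiningFunction Ω U ρ) (hΩ : IsC2Admissible Ω) (hs : s ∈ U)
    (hf : s ∈ frontier Ω) {v : EuclideanSpace ℝ (Fin ν)} (hv : v ∈ tangent Ω s) :
    fderivWithin ℝ (normal Ω) (frontier Ω) s v = fderiv ℝ (unitGradient ρ) s v := by
  have h1 : HasFDerivWithinAt (normal Ω) (fderiv ℝ (unitGradient ρ) s) (frontier Ω) s := by
    refine (((h.contDiffAt_unitGradient hs).differentiableAt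
      one_ne_zero).hasFDerivAt.hasFDerivWithinAt).congr_of_eventuallyEq ?_
      (h.normal_eq hΩ.isOpen hs hf)
    filter_upwards [self_mem_nhdsWithin, mem_nhdsWithin_of_mem_nhds (h.eventually_mem hs)]
      with x hx hxU using h.normal_eq hΩ.isOpen hxU hx
  exact h1.differentiableWithinAt.hasFDerivWithinAt.unique_on h1
    (mem_tangentConeAt_frontier hΩ hf hv)

/-- The curvature as the trace of the derivative of the normalized gradient over the tangent
space, written without reference to that space. -/
lemma curvature_eq (h : IsDefiningFunction Ω U ρ) (hΩ : IsC2Admissible Ω) (hs : s ∈ U)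
    (hf : s ∈ frontier Ω) : curvature Ω s =
      LinearMap.trace ℝ _ (fderiv ℝ (unitGradient ρ) s).toLinearMap -
        ⟪unitGradient ρ s, fderiv ℝ (unitGradient ρ) s (unitGradient ρ s)⟫ := by
  set A := fderiv ℝ (unitGradient ρ) s
  have hn := norm_normal hΩ hf
  have hproj : ∀ v, (((tangent Ω s).orthogonalProjectionOnto v : tangent Ω s) :
      EuclideanSpace ℝ (Fin ν)) = v - ⟪normal Ω s, v⟫ • normal Ω s := by
    intro v
    rw [← Submodule.starProjection_apply, Submodule.starProjection_orthogonal_val,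
      Submodule.starProjection_unit_singleton ℝ hn]
  have h1 : (shapeOperator Ω s).toLinearMap =
      ((tangent Ω s).orthogonalProjectionOnto : _ →L[ℝ] tangent Ω s).toLinearMap ∘ₗ
        (A.toLinearMap ∘ₗ (tangent Ω s).subtype) := by
    refine LinearMap.ext fun v => ?_
    simp only [shapeOperator, ContinuousLinearMap.toLinearMap_comp, LinearMap.comp_apply]
    congr 1
    exact h.fderivWithin_normal_eq hΩ hs hf v.2
  have h2 : (A.toLinearMap ∘ₗ (tangent Ω s).subtype) ∘ₗ
      ((tangent Ω s).orthogonalProjectionOnto : _ →L[ℝ] tangent Ω s).toLinearMap =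
      A.toLinearMap - (InnerProductSpace.rankOne ℝ (A (normal Ω s)) (normal Ω s)).toLinearMap := by
    refine LinearMap.ext fun v => ?_
    have : (tangent Ω s).subtype ((tangent Ω s).orthogonalProjectionOnto v) = _ := hproj v
    simp only [LinearMap.comp_apply, ContinuousLinearMap.coe_coe, LinearMap.sub_apply,
      InnerProductSpace.rankOne_apply]
    rw [this, map_sub, map_smul]
  rw [curvature, h1, LinearMap.trace_comp_comm', h2, map_sub, InnerProductSpace.trace_rankOne,
    h.normal_eq hΩ.isOpen hs hf]

end IsDefiningFunction

lemma continuousOn_normal (hΩ : IsC2Admissible Ω) : ContinuousOn (normal Ω) (frontier Ω) := by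
  intro s hf
  obtain ⟨U, ρ, hs, h⟩ := hΩ.boundary s hf
  refine ((h.contDiffAt_unitGradient hs).continuousAt.continuousWithinAt).congr_of_eventuallyEq ?_
      (h.normal_eq hΩ.isOpen hs hf)
  filter_upwards [self_mem_nhdsWithin, mem_nhdsWithin_of_mem_nhds (h.eventually_mem hs)]
      with x hx hxU using h.normal_eq hΩ.isOpen hxU hx

lemma continuousOn_curvature (hΩ : IsC2Admissible Ω) :
    ContinuousOn (curvature Ω) (frontier Ω) := by
  intro s hf
  obtain ⟨U, ρ, hs, h⟩ := hΩ.boundary s hf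
  have hA : ContinuousAt (fderiv ℝ (unitGradient ρ)) s :=
    ((h.contDiffAt_unitGradient hs).fderiv_right (m := 0) (by norm_num)).continuousAt
  have hn := (h.contDiffAt_unitGradient hs).continuousAt
  have htr : Continuous fun B : EuclideanSpace ℝ (Fin ν) →L[ℝ] EuclideanSpace ℝ (Fin ν) =>
      LinearMap.trace ℝ _ B.toLinearMap :=
    ((LinearMap.trace ℝ (EuclideanSpace ℝ (Fin ν))) ∘ₗ
      ContinuousLinearMap.coeLM ℝ).continuous_of_finiteDimensional
  refine (ContinuousAt.continuousWithinAt ((htr.continuousAt.comp hA).sub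
    (hn.inner (𝕜 := ℝ) (hA.clm_apply hn)))).congr_of_eventuallyEq ?_ (h.curvature_eq hΩ hs hf)
  filter_upwards [self_mem_nhdsWithin, mem_nhdsWithin_of_mem_nhds (h.eventually_mem hs)]
      with x hx hxU using h.curvature_eq hΩ hxU hx

lemma isSymmetric_shapeOperator (hΩ : IsC2Admissible Ω) (hf : s ∈ frontier Ω) :
    (shapeOperator Ω s).toLinearMap.IsSymmetric := by
  obtain ⟨U, ρ, hs, h⟩ := hΩ.boundary s hf
  have key : ∀ v w : tangent Ω s, ⟪shapeOperator Ω s v, w⟫ =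
      ⟪fderiv ℝ (unitGradient ρ) s v, (w : EuclideanSpace ℝ (Fin ν))⟫ := by
    intro v w
    rw [← h.fderivWithin_normal_eq hΩ hs hf v.2]
    exact Submodule.inner_orthogonalProjectionOnto_eq_of_mem_right w _
  have hT : ∀ v : tangent Ω s, ⟪unitGradient ρ s, (v : EuclideanSpace ℝ (Fin ν))⟫ = 0 := by
    intro v
    rw [← h.normal_eq hΩ.isOpen hs hf]
    exact mem_tangent_iff.1 v.2
  intro v w
  change ⟪shapeOperator Ω s v, w⟫ = ⟪v, shapeOperator Ω s w⟫
  rw [key, real_inner_comm _ v, key]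
  exact h.inner_fderiv_unitGradient_comm hs (hT v) (hT w)

/-- The curvature is bounded, being the sum of the bounded eigenvalues of a symmetric operator. -/
lemma exists_abs_curvature_le (hΩ : IsC2Admissible Ω) :
    ∃ C : ℝ, ∀ s ∈ frontier Ω, |curvature Ω s| ≤ C := by
  obtain ⟨M, hM⟩ := hΩ.curvature_bounded
  refine ⟨ν * |M|, fun s hf => ?_⟩
  have hsym := isSymmetric_shapeOperator hΩ hf
  rw [curvature, hsym.trace_eq_sum_eigenvalues rfl]
  calc _ ≤ ∑ i, |hsym.eigenvalues rfl i| := Finset.abs_sum_le_sum_abs _ _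
    _ ≤ ∑ _i : Fin (Module.finrank ℝ (tangent Ω s)), |M| := by
        refine Finset.sum_le_sum fun i _ => (hM s hf _ ?_).trans (le_abs_self M)
        exact hsym.hasEigenvalue_eigenvalues rfl i
    _ ≤ ν * |M| := by
        rw [Finset.sum_const, Finset.card_univ, Fintype.card_fin, nsmul_eq_mul]
        gcongr
        simpa using Submodule.finrank_le (tangent Ω s)

lemma curvature_le_curvatureMax (hΩ : IsC2Admissible Ω) (hf : s ∈ frontier Ω) :
    curvature Ω s ≤ curvatureMax Ω := by
  obtain ⟨C, hC⟩ := exists_abs_curvature_le hΩ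
  refine le_csSup ⟨C, ?_⟩ (mem_image_of_mem _ hf)
  rintro _ ⟨x, hx, rfl⟩
  exact (le_abs_self _).trans (hC x hx)

/-! ### The surface measure -/

lemma euclideanHausdorffMeasure_le_of_antilipschitz {X Y : Type*} [MetricSpace X]
    [MeasurableSpace X] [BorelSpace X] [MetricSpace Y] [MeasurableSpace Y] [BorelSpace Y] (d : ℕ)
    {A : Set X} {f : X → Y} {K : ℝ≥0} (hf : ∀ x ∈ A, ∀ y ∈ A, dist x y ≤ K * dist (f x) (f y)) :
    μHE[d] A ≤ (K : ℝ≥0∞) ^ (d : ℝ) * μHE[d] (f '' A) := by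
  have h1 : AntilipschitzWith K (fun x : A => f x) :=
    AntilipschitzWith.of_le_mul_dist fun x y => hf x x.2 y y.2
  have h2 := h1.le_hausdorffMeasure_image (Nat.cast_nonneg d) univ
  rw [← (isometry_subtype_coe (s := A)).hausdorffMeasure_image (Or.inl (Nat.cast_nonneg d)),
    image_univ, Subtype.range_coe, image_univ, ← image_eq_range] at h2
  simp only [Measure.euclideanHausdorffMeasure_def, Measure.smul_apply, ENNReal.smul_def,
    smul_eq_mul]
  rw [mul_left_comm]
  gcongr

lemma euclideanHausdorffMeasure_image_le {X Y : Type*} [MetricSpace X]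
    [MeasurableSpace X] [BorelSpace X] [MetricSpace Y] [MeasurableSpace Y] [BorelSpace Y] (d : ℕ)
    {f : X → Y} (hf : LipschitzWith 1 f) (A : Set X) : μHE[d] (f '' A) ≤ μHE[d] A := by
  have h := hf.hausdorffMeasure_image_le (Nat.cast_nonneg d) A
  simp only [Measure.euclideanHausdorffMeasure_def, Measure.smul_apply, ENNReal.smul_def,
    smul_eq_mul]
  gcongr
  simpa using h

/-- Linear coordinates `P` on the hyperplane orthogonal to a unit vector `n`, with inverse `J`. -/
lemma exists_hyperplane_coordinates {ν : ℕ} (hν : 1 ≤ ν) {n : EuclideanSpace ℝ (Fin ν)}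
    (hn : ‖n‖ = 1) :
    ∃ (P : EuclideanSpace ℝ (Fin ν) →L[ℝ] EuclideanSpace ℝ (Fin (ν - 1)))
      (J : EuclideanSpace ℝ (Fin (ν - 1)) →ₗᵢ[ℝ] EuclideanSpace ℝ (Fin ν)),
      (∀ v, ‖v‖ ^ 2 = ‖P v‖ ^ 2 + ⟪n, v⟫ ^ 2) ∧ ∀ y, ⟪n, J y⟫ = 0 ∧ P (J y) = y := by
  have : Fact (Module.finrank ℝ (EuclideanSpace ℝ (Fin ν)) = (ν - 1) + 1) :=
    ⟨by rw [finrank_euclideanSpace_fin]; omega⟩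
  have hn0 : n ≠ 0 := by rw [← norm_ne_zero_iff, hn]; exact one_ne_zero
  let e := (OrthonormalBasis.fromOrthogonalSpanSingleton (𝕜 := ℝ) (ν - 1) hn0).repr
  refine ⟨e.toContinuousLinearEquiv.toContinuousLinearMap.comp
      (Submodule.span ℝ {n})ᗮ.orthogonalProjectionOnto,
    (Submodule.span ℝ {n})ᗮ.subtypeₗᵢ.comp e.symm.toLinearIsometry, fun v => ?_, fun y => ⟨?_, ?_⟩⟩
  · have h1 : ‖e ((Submodule.span ℝ {n})ᗮ.orthogonalProjectionOnto v)‖ =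
        ‖v - ⟪n, v⟫ • n‖ := by
      rw [e.norm_map, ← Submodule.norm_coe, ← Submodule.starProjection_apply,
        Submodule.starProjection_orthogonal_val, Submodule.starProjection_unit_singleton ℝ hn]
    change ‖v‖ ^ 2 = ‖e ((Submodule.span ℝ {n})ᗮ.orthogonalProjectionOnto v)‖ ^ 2 + _
    rw [h1, norm_sub_sq_real, norm_smul, hn, inner_smul_right, real_inner_comm, Real.norm_eq_abs,
      mul_one, sq_abs]
    ring
  · exact Submodule.mem_orthogonal_singleton_iff_inner_right.1 (e.symm y).2
  · change e ((Submodule.span ℝ {n})ᗮ.orthogonalProjectionOnto (e.symm y : _)) = y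
    rw [Submodule.orthogonalProjectionOnto_mem_subspace_eq_self, e.apply_symm_apply]

/-- The boundary has locally finite area, because the projection to a tangent plane has a Lipschitz
inverse near the point of contact. -/
lemma exists_surfaceMeasure_ball_lt_top (hν : 1 ≤ ν) (hΩ : IsC2Admissible Ω)
    (hf : s ∈ frontier Ω) : ∃ r > 0, surfaceMeasure Ω (Metric.ball s r) < ∞ := by
  obtain ⟨P, J, hP, -⟩ := exists_hyperplane_coordinates hν (norm_normal hΩ hf)
  obtain ⟨r, hr, h⟩ := exists_abs_inner_normal_le hΩ hf (show (0 : ℝ) < 1 / 2 by norm_num)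
  refine ⟨r, hr, ?_⟩
  rw [surfaceMeasure, Measure.restrict_apply Metric.isOpen_ball.measurableSet, inter_comm]
  refine (euclideanHausdorffMeasure_le_of_antilipschitz (K := 2) (f := P) (ν - 1)
    fun x hx y hy => ?_).trans_lt (ENNReal.mul_lt_top (by simp) ?_)
  · rw [dist_eq_norm, dist_eq_norm, ← map_sub]
    have h1 := abs_le_iff_mul_self_le.1 ((h x hx y hy).trans (le_abs_self _))
    have h2 := hP (x - y)
    refine abs_le_of_sq_le_sq' ?_ (by positivity) |>.2
    rw [NNReal.coe_ofNat]
    nlinarith [sq_nonneg ‖x - y‖]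
  · rw [EuclideanSpace.euclideanHausdorffMeasure_eq_volume]
    have hb : Bornology.IsBounded (P '' (frontier Ω ∩ Metric.ball s r)) :=
      P.lipschitz.isBounded_image (Metric.isBounded_ball.subset inter_subset_right)
    exact hb.measure_lt_top

/-- The boundary has positive area near each of its points, because its projection to the tangent
plane covers a neighbourhood of the point of contact. -/
lemma surfaceMeasure_ball_pos (hν : 1 ≤ ν) (hΩ : IsC2Admissible Ω) (hf : s ∈ frontier Ω) {r : ℝ}
    (hr : 0 < r) : 0 < surfaceMeasure Ω (Metric.ball s r) := by
  have hn := norm_normal hΩ hf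
  obtain ⟨P, J, hP, hJ⟩ := exists_hyperplane_coordinates hν hn
  obtain ⟨r', hr', h⟩ := exists_add_smul_normal_mem_frontier hΩ hf one_pos
  have hPle : ∀ v, ‖P v‖ ≤ ‖v‖ := fun v => by
    refine abs_le_of_sq_le_sq' ?_ (norm_nonneg v) |>.2
    rw [hP v]; linarith [sq_nonneg ⟪normal Ω s, v⟫]
  have hPn : P (normal Ω s) = 0 := by
    have := hP (normal Ω s)
    rw [real_inner_self_eq_norm_sq, hn] at this
    simpa using this
  have hlip : LipschitzWith 1 P := LipschitzWith.of_dist_le_mul fun x y => by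
    rw [dist_eq_norm, dist_eq_norm, ← map_sub, NNReal.coe_one, one_mul]
    exact hPle _
  rw [surfaceMeasure, Measure.restrict_apply Metric.isOpen_ball.measurableSet]
  refine lt_of_lt_of_le ?_ (euclideanHausdorffMeasure_image_le (ν - 1) hlip _)
  rw [EuclideanSpace.euclideanHausdorffMeasure_eq_volume]
  refine lt_of_lt_of_le (Metric.measure_ball_pos volume (P s)
    (show 0 < min r' (r / 2) by positivity)) (measure_mono fun y hy => ?_)
  have hy' : ‖J (y - P s)‖ < min r' (r / 2) := by
    rw [J.norm_map, ← dist_eq_norm]; exact hy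
  obtain ⟨τ, hτ, hmem⟩ := h (J (y - P s)) (hJ _).1 (hy'.trans_le (min_le_left _ _))
  refine ⟨_, ⟨?_, hmem⟩, ?_⟩
  · rw [mem_ball_iff_norm, add_sub_cancel_left]
    calc _ ≤ ‖J (y - P s)‖ + ‖τ • normal Ω s‖ := norm_add_le _ _
      _ ≤ ‖J (y - P s)‖ + 1 * ‖J (y - P s)‖ := by
        rw [norm_smul, hn, mul_one]; gcongr; exact hτ
      _ < r := by linarith [hy'.trans_le (min_le_right _ _)]
  · rw [map_add, map_add, map_smul, hPn, (hJ _).2]; simp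

/-- Local parametrizations pull back null sets of the surface measure to Lebesgue null sets, because
an immersion has locally a Lipschitz inverse. -/
lemma IsLocalParam.ae_comp {U : Set (EuclideanSpace ℝ (Fin (ν - 1)))}
    {ψ : EuclideanSpace ℝ (Fin (ν - 1)) → EuclideanSpace ℝ (Fin ν)} (hψ : IsLocalParam Ω U ψ)
    {p : EuclideanSpace ℝ (Fin ν) → Prop} (hp : ∀ᵐ x ∂surfaceMeasure Ω, p x) :
    ∀ᵐ x, x ∈ U → p (ψ x) := by
  rw [surfaceMeasure, ae_restrict_iff' measurableSet_frontier, ae_iff] at hp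
  rw [ae_iff]
  refine measure_null_of_locally_null _ fun x hx => ?_
  have hxU : x ∈ U := by
    by_contra hxU
    exact hx fun h => absurd h hxU
  obtain ⟨K, hK0, hK⟩ := (fderiv ℝ ψ x).toLinearMap.exists_antilipschitzWith
    (LinearMap.ker_eq_bot.2 (hψ.immersion x hxU))
  have hstrict := (hψ.contDiffOn.contDiffAt (hψ.isOpen.mem_nhds hxU)).hasStrictFDerivAt
    (by norm_num)
  have hK0' : (0 : ℝ) < K := hK0
  have h1 := hstrict.isLittleO.def (show (0 : ℝ) < 1 / (2 * K) by positivity)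
  rw [nhds_prod_eq] at h1
  obtain ⟨V, hV, hVs⟩ := Filter.eventually_prod_self_iff
    (r := fun y z => ‖ψ y - ψ z - fderiv ℝ ψ x (y - z)‖ ≤ 1 / (2 * K) * ‖y - z‖) |>.1 h1
  refine ⟨_, inter_mem_nhdsWithin _ hV, ?_⟩
  rw [← EuclideanSpace.euclideanHausdorffMeasure_eq_volume]
  refine le_antisymm ((euclideanHausdorffMeasure_le_of_antilipschitz (K := 2 * K) (f := ψ) (ν - 1)
    fun y hy z hz => ?_).trans ?_) zero_le
  · have h2 := hVs y hy.2 z hz.2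
    have h3 : ‖y - z‖ ≤ K * ‖fderiv ℝ ψ x (y - z)‖ := by
      simpa [dist_eq_norm] using hK.le_mul_dist (y - z) 0
    have h4 : ‖fderiv ℝ ψ x (y - z)‖ ≤ ‖ψ y - ψ z‖ + 1 / (2 * K) * ‖y - z‖ := by
      have := norm_sub_le (ψ y - ψ z) (ψ y - ψ z - fderiv ℝ ψ x (y - z))
      rw [sub_sub_cancel] at this
      linarith
    have h5 : K * ‖fderiv ℝ ψ x (y - z)‖ ≤ K * ‖ψ y - ψ z‖ + 1 / 2 * ‖y - z‖ := by
      calc _ ≤ K * (‖ψ y - ψ z‖ + 1 / (2 * K) * ‖y - z‖) := by gcongr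
        _ = _ := by field_simp
    rw [dist_eq_norm, dist_eq_norm]
    push_cast
    linarith
  · refine (mul_le_mul_right (measure_mono (t := {a | ¬ (a ∈ frontier Ω → p a)}) ?_) _).trans ?_
    · rintro _ ⟨y, ⟨hy, -⟩, rfl⟩ hc
      exact hy fun hyU => hc (hψ.mapsTo hyU)
    · rw [hp, mul_zero]

/-! ### Restrictions of smooth functions to the boundary -/

/-- The tangential part of the gradient of `f` along the boundary of `Ω`. -/
def tangentialGradient {ν : ℕ} (Ω : Set (EuclideanSpace ℝ (Fin ν)))
    (f : EuclideanSpace ℝ (Fin ν) → ℝ) (s : EuclideanSpace ℝ (Fin ν)) :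
    EuclideanSpace ℝ (Fin ν) :=
  gradient f s - ⟪normal Ω s, gradient f s⟫ • normal Ω s

variable {f : EuclideanSpace ℝ (Fin ν) → ℝ}

lemma continuous_gradient (hf : ContDiff ℝ 1 f) : Continuous (gradient f) :=
  (InnerProductSpace.toDual ℝ (EuclideanSpace ℝ (Fin ν))).symm.continuous.comp
    (hf.continuous_fderiv one_ne_zero)

lemma tangentialGradient_mem_tangent (hΩ : IsC2Admissible Ω) (hs : s ∈ frontier Ω) :
    tangentialGradient Ω f s ∈ tangent Ω s := by
  rw [mem_tangent_iff, tangentialGradient, inner_sub_right, inner_smul_right,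
    real_inner_self_eq_norm_sq, norm_normal hΩ hs]
  ring

/-- The differential of a local parametrization is tangent to the boundary, because a defining
function vanishes identically along the parametrization. -/
lemma IsLocalParam.inner_normal_fderiv {U : Set (EuclideanSpace ℝ (Fin (ν - 1)))}
    {ψ : EuclideanSpace ℝ (Fin (ν - 1)) → EuclideanSpace ℝ (Fin ν)} (hψ : IsLocalParam Ω U ψ)
    (hΩ : IsC2Admissible Ω) {x : EuclideanSpace ℝ (Fin (ν - 1))} (hx : x ∈ U)
    (e : EuclideanSpace ℝ (Fin (ν - 1))) : ⟪normal Ω (ψ x), fderiv ℝ ψ x e⟫ = 0 := by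
  obtain ⟨V, ρ, hs, h⟩ := hΩ.boundary _ (hψ.mapsTo hx)
  have hψd : ContDiffAt ℝ 2 ψ x := hψ.contDiffOn.contDiffAt (hψ.isOpen.mem_nhds hx)
  have h1 := (h.hasStrictFDerivAt hs).hasFDerivAt.comp x
    (hψd.differentiableAt two_ne_zero).hasFDerivAt
  have h2 : ρ ∘ ψ =ᶠ[𝓝 x] fun _ => 0 := by
    filter_upwards [hψ.isOpen.mem_nhds hx, hψd.continuousAt.eventually (h.eventually_mem hs)]
      with y hy hyV using h.eq_zero_of_mem_frontier hΩ.isOpen hyV (hψ.mapsTo hy)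
  have h3 := h1.unique ((hasFDerivAt_const (0 : ℝ) x).congr_of_eventuallyEq h2)
  have h4 := DFunLike.congr_fun h3 e
  rw [h.normal_eq hΩ.isOpen hs (hψ.mapsTo hx)]
  exact (mul_eq_zero.1 h4).resolve_left (h.norm_gradient_pos hs).ne'

/-- Bounded continuous functions on the boundary that vanish off a set of finite area are square
integrable. -/
lemma memLp_of_bounded_of_support {F : Type*} [NormedAddCommGroup F]
    {g : EuclideanSpace ℝ (Fin ν) → F} (hg : ContinuousOn g (frontier Ω))
    {A : Set (EuclideanSpace ℝ (Fin ν))} (hA : MeasurableSet A) (hfin : surfaceMeasure Ω A < ∞)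
    (hsupp : ∀ x ∉ A, g x = 0) {C : ℝ} (hC : ∀ x ∈ frontier Ω, ‖g x‖ ≤ C) :
    MemLp g 2 (surfaceMeasure Ω) := by
  have hmeas : AEStronglyMeasurable g (surfaceMeasure Ω) :=
    hg.aestronglyMeasurable measurableSet_frontier
  have h1 : A.indicator g = g := indicator_eq_self.2 fun x hx => by
    by_contra hxA
    exact hx (hsupp x hxA)
  rw [← h1, memLp_indicator_iff_restrict hA]
  have : IsFiniteMeasure ((surfaceMeasure Ω).restrict A) := ⟨by simpa using hfin⟩
  refine MemLp.of_bound hmeas.restrict C (ae_restrict_of_ae ?_)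
  rw [surfaceMeasure, ae_restrict_iff' measurableSet_frontier]
  exact Eventually.of_forall hC

lemma memLp_of_contDiff (hf : ContDiff ℝ 1 f) (hc : HasCompactSupport f)
    (hfin : surfaceMeasure Ω (tsupport f) < ∞) : MemLp f 2 (surfaceMeasure Ω) := by
  obtain ⟨C, hC⟩ := hc.exists_bound_of_continuous hf.continuous
  exact memLp_of_bounded_of_support hf.continuous.continuousOn (isClosed_tsupport f).measurableSet
    hfin (fun x hx => image_eq_zero_of_notMem_tsupport hx) fun x _ => hC x

lemma gradient_eq_zero_of_notMem_tsupport {x : EuclideanSpace ℝ (Fin ν)} (hx : x ∉ tsupport f) :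
    gradient f x = 0 := by
  rw [gradient, fderiv_of_notMem_tsupport ℝ hx, map_zero]

lemma memLp_tangentialGradient (hΩ : IsC2Admissible Ω) (hf : ContDiff ℝ 1 f)
    (hc : HasCompactSupport f) (hfin : surfaceMeasure Ω (tsupport f) < ∞) :
    MemLp (tangentialGradient Ω f) 2 (surfaceMeasure Ω) := by
  have hcg : HasCompactSupport (gradient f) :=
    HasCompactSupport.intro hc fun x hx => gradient_eq_zero_of_notMem_tsupport hx
  obtain ⟨C, hC⟩ := hcg.exists_bound_of_continuous (continuous_gradient hf)
  have hn := continuousOn_normal hΩ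
  have hg := (continuous_gradient hf).continuousOn (s := frontier Ω)
  have hcont : ContinuousOn (tangentialGradient Ω f) (frontier Ω) :=
    hg.sub ((hn.inner (𝕜 := ℝ) hg).smul hn)
  refine memLp_of_bounded_of_support hcont
    (isClosed_tsupport f).measurableSet hfin (fun x hx => ?_) (C := C + C) fun x hx => ?_
  · simp [tangentialGradient, gradient_eq_zero_of_notMem_tsupport hx]
  · refine (norm_sub_le _ _).trans (add_le_add (hC x) ?_)
    rw [norm_smul, norm_normal hΩ hx, mul_one]
    refine (norm_inner_le_norm _ _).trans ?_
    rw [norm_normal hΩ hx, one_mul]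
    exact hC x

/-- The restriction to the boundary of a compactly supported `C¹` function lies in `H¹`, and its
weak gradient is the tangential part of the gradient. -/
lemma isWeakGradient_toLp (hΩ : IsC2Admissible Ω) (hf : ContDiff ℝ 1 f)
    (hL : MemLp f 2 (surfaceMeasure Ω)) (hG : MemLp (tangentialGradient Ω f) 2 (surfaceMeasure Ω)) :
    IsWeakGradient Ω (hL.toLp f) (hG.toLp _) := by
  refine ⟨?_, fun U ψ hψ η hη hηc hηU e => ?_⟩
  · filter_upwards [hG.coeFn_toLp,
      (ae_restrict_mem measurableSet_frontier : ∀ᵐ s ∂surfaceMeasure Ω, s ∈ frontier Ω)]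
      with s hs hsf
    rw [hs]
    exact tangentialGradient_mem_tangent hΩ hsf
  have hψd : ∀ x ∈ U, ContDiffAt ℝ 2 ψ x := fun x hx =>
    hψ.contDiffOn.contDiffAt (hψ.isOpen.mem_nhds hx)
  have hcomp : ContDiffOn ℝ 1 (f ∘ ψ) U :=
    hf.comp_contDiffOn (hψ.contDiffOn.of_le (by norm_num))
  have hdiff : ∀ x ∈ U, DifferentiableAt ℝ (f ∘ ψ) x := fun x hx =>
    (hcomp.contDiffAt (hψ.isOpen.mem_nhds hx)).differentiableAt one_ne_zero
  -- This is the chain rule: the normal part of the gradient of `f` does not contribute.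
  have hchain : ∀ x ∈ U, ⟪tangentialGradient Ω f (ψ x), fderiv ℝ ψ x e⟫ =
      fderiv ℝ (f ∘ ψ) x e := by
    intro x hx
    rw [tangentialGradient, inner_sub_left, real_inner_smul_left, hψ.inner_normal_fderiv hΩ hx,
      mul_zero, sub_zero, fderiv_comp x (hf.differentiable one_ne_zero _)
        ((hψd x hx).differentiableAt two_ne_zero)]
    exact InnerProductSpace.toDual_symm_apply
  have hη0 : ∀ x ∉ U, η x = 0 := fun x hx =>
    image_eq_zero_of_notMem_tsupport fun h => hx (hηU h)
  have hη1 : ∀ x ∉ U, fderiv ℝ η x = 0 := fun x hx =>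
    fderiv_of_notMem_tsupport ℝ fun h => hx (hηU h)
  -- The chosen representatives in `L²` agree with `f` and its tangential gradient along `ψ`, up to
  -- a Lebesgue null set.
  have hl : ∫ x, (hL.toLp f) (ψ x) * fderiv ℝ η x e = ∫ x, (f ∘ ψ) x * fderiv ℝ η x e := by
    refine integral_congr_ae ?_
    filter_upwards [hψ.ae_comp hL.coeFn_toLp] with x hx
    by_cases hxU : x ∈ U
    · rw [hx hxU]; rfl
    · simp [hη1 x hxU]
  have hr : ∫ x, ⟪(hG.toLp _) (ψ x), fderiv ℝ ψ x e⟫ * η x =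
      ∫ x, fderiv ℝ (f ∘ ψ) x e * η x := by
    refine integral_congr_ae ?_
    filter_upwards [hψ.ae_comp hG.coeFn_toLp] with x hx
    by_cases hxU : x ∈ U
    · rw [hx hxU, hchain x hxU]
    · simp [hη0 x hxU]
  rw [hl, hr]
  have hηcont : Continuous fun x => fderiv ℝ η x e :=
    (hη.continuous_fderiv (by simp)).clm_apply continuous_const
  have hη1supp : tsupport (fun x => fderiv ℝ η x e) ⊆ tsupport η :=
    tsupport_fderiv_apply_subset ℝ e
  have hfcont : ContinuousOn (fun x => fderiv ℝ (f ∘ ψ) x e) U :=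
    (hcomp.continuousOn_fderiv_of_isOpen hψ.isOpen le_rfl).clm_apply continuousOn_const
  -- Products of a function continuous on `U` with a test function are integrable.
  have hint : ∀ g k : EuclideanSpace ℝ (Fin (ν - 1)) → ℝ, ContinuousOn g U → Continuous k →
      tsupport k ⊆ tsupport η → Integrable (fun x => g x * k x) := by
    intro g k hg hk hkη
    have hsupp : tsupport (fun x => g x * k x) ⊆ tsupport η :=
      (tsupport_mul_subset_right (f := g) (g := k)).trans hkη
    refine Continuous.integrable_of_hasCompactSupport ?_
      (hηc.mono' (subset_tsupport _ |>.trans hsupp))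
    exact ContinuousOn.continuous_of_tsupport_subset (hg.mul hk.continuousOn) hψ.isOpen
      (hsupp.trans hηU)
  exact integral_mul_fderiv_eq_neg_fderiv_mul_of_integrable
    (hint _ _ hfcont hη.continuous subset_rfl)
    (hint _ _ hcomp.continuousOn hηcont hη1supp)
    (hint _ _ hcomp.continuousOn hη.continuous subset_rfl)
    (fun x hx => hdiff x (hηU hx)) (fun x _ => (hη.differentiable (by simp)) x)

/-! ### The quadratic form and its Rayleigh quotients -/

lemma integral_norm_sq_eq {F : Type*} [NormedAddCommGroup F] [InnerProductSpace ℝ F]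
    (G : Lp F 2 (surfaceMeasure Ω)) : ∫ s, ‖G s‖ ^ 2 ∂surfaceMeasure Ω = ‖G‖ ^ 2 := by
  rw [← real_inner_self_eq_norm_sq, MeasureTheory.L2.inner_def]
  simp only [real_inner_self_eq_norm_sq]

lemma integral_sq_eq (u : L2 Ω) : ∫ s, u s ^ 2 ∂surfaceMeasure Ω = ‖u‖ ^ 2 := by
  rw [← integral_norm_sq_eq]
  simp

lemma dirichlet_nonneg (u : L2 Ω) : 0 ≤ dirichlet Ω u := by
  refine Real.sInf_nonneg ?_
  rintro _ ⟨G, -, rfl⟩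
  positivity

lemma dirichlet_le {u : L2 Ω} {G : L2Field Ω} (h : IsWeakGradient Ω u G) :
    dirichlet Ω u ≤ ‖G‖ ^ 2 := by
  refine csInf_le ⟨0, ?_⟩ ⟨G, h, (integral_norm_sq_eq G).symm⟩
  rintro _ ⟨G, -, rfl⟩
  positivity

lemma ae_mem_frontier : ∀ᵐ s ∂surfaceMeasure Ω, s ∈ frontier Ω :=
  ae_restrict_mem measurableSet_frontier

lemma integral_curvature_mul_sq_le (hΩ : IsC2Admissible Ω) (u : L2 Ω) :
    ∫ s, curvature Ω s * u s ^ 2 ∂surfaceMeasure Ω ≤ curvatureMax Ω * ‖u‖ ^ 2 := by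
  obtain ⟨C, hC⟩ := exists_abs_curvature_le hΩ
  have hu : Integrable (fun s => u s ^ 2) (surfaceMeasure Ω) := (Lp.memLp u).integrable_sq
  have hK : AEStronglyMeasurable (curvature Ω) (surfaceMeasure Ω) :=
    (continuousOn_curvature hΩ).aestronglyMeasurable measurableSet_frontier
  have hint : Integrable (fun s => curvature Ω s * u s ^ 2) (surfaceMeasure Ω) :=
    hu.bdd_mul hK (c := C) (ae_mem_frontier.mono fun s hs => hC s hs)
  rw [← integral_sq_eq, ← integral_const_mul]
  refine integral_mono_ae hint (hu.const_mul _) ?_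
  filter_upwards [ae_mem_frontier] with s hs
  exact mul_le_mul_of_nonneg_right (curvature_le_curvatureMax hΩ hs) (sq_nonneg _)

lemma le_rayleigh (hΩ : IsC2Admissible Ω) {α : ℝ} (hα : 0 ≤ α) {j : ℕ} (hj : 1 ≤ j) :
    ((-α * curvatureMax Ω : ℝ) : EReal) ≤ rayleigh Ω α j := by
  refine le_iInf fun L => le_iInf fun _ => le_iInf fun hdim => ?_
  have hL : L ≠ ⊥ := by
    rintro rfl
    rw [finrank_bot] at hdim
    omega
  obtain ⟨u, huL, hu⟩ := L.exists_mem_ne_zero_of_ne_bot hL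
  refine le_iSup_of_le u (le_iSup_of_le huL (le_iSup_of_le hu ?_))
  rw [EReal.coe_le_coe_iff, le_div_iff₀ (by positivity), form]
  have h1 := dirichlet_nonneg u
  have h2 := mul_le_mul_of_nonneg_left (integral_curvature_mul_sq_le hΩ u) hα
  linarith

/-- The space of `C¹` functions on `ℝ^ν` that vanish off `B`. -/
def c1SupportedIn {ν : ℕ} (B : Set (EuclideanSpace ℝ (Fin ν))) :
    Submodule ℝ (EuclideanSpace ℝ (Fin ν) → ℝ) where
  carrier := {f | ContDiff ℝ 1 f ∧ ∀ x ∉ B, f x = 0}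
  zero_mem' := ⟨contDiff_const, fun _ _ => rfl⟩
  add_mem' hf hg := ⟨hf.1.add hg.1, fun x hx => by simp [hf.2 x hx, hg.2 x hx]⟩
  smul_mem' c _ hf := ⟨contDiff_const.smul hf.1, fun x hx => by simp [hf.2 x hx]⟩

lemma tangentialGradient_add {f g : EuclideanSpace ℝ (Fin ν) → ℝ} (hf : ContDiff ℝ 1 f)
    (hg : ContDiff ℝ 1 g) : tangentialGradient Ω (f + g) =
      tangentialGradient Ω f + tangentialGradient Ω g := by
  funext x
  have h : gradient (f + g) x = gradient f x + gradient g x := by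
    rw [gradient, fderiv_add (hf.differentiable one_ne_zero x) (hg.differentiable one_ne_zero x),
      map_add]
    rfl
  simp only [tangentialGradient, h, inner_add_right, Pi.add_apply]
  module

lemma tangentialGradient_smul (c : ℝ) {f : EuclideanSpace ℝ (Fin ν) → ℝ} (hf : ContDiff ℝ 1 f) :
    tangentialGradient Ω (c • f) = c • tangentialGradient Ω f := by
  funext x
  have h : gradient (c • f) x = c • gradient f x := by
    rw [gradient, fderiv_const_smul (hf.differentiable one_ne_zero x), map_smul]
    rfl
  simp only [tangentialGradient, h, inner_smul_right, Pi.smul_apply]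
  module

section Restriction

variable {B : Set (EuclideanSpace ℝ (Fin ν))}

lemma tsupport_subset_of_mem (hB : IsCompact B) (f : c1SupportedIn B) :
    tsupport (f : EuclideanSpace ℝ (Fin ν) → ℝ) ⊆ B :=
  closure_minimal (fun x hx => by_contra fun hxB => hx (f.2.2 x hxB)) hB.isClosed

lemma memLp_coe (hB : IsCompact B) (hfin : surfaceMeasure Ω B < ∞) (f : c1SupportedIn B) :
    MemLp (f : EuclideanSpace ℝ (Fin ν) → ℝ) 2 (surfaceMeasure Ω) :=
  memLp_of_contDiff f.2.1 (hB.of_isClosed_subset (isClosed_tsupport _)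
    (tsupport_subset_of_mem hB f)) ((measure_mono (tsupport_subset_of_mem hB f)).trans_lt hfin)

lemma memLp_tangentialGradient_coe (hB : IsCompact B) (hfin : surfaceMeasure Ω B < ∞)
    (hΩ : IsC2Admissible Ω) (f : c1SupportedIn B) :
    MemLp (tangentialGradient Ω f) 2 (surfaceMeasure Ω) :=
  memLp_tangentialGradient hΩ f.2.1 (hB.of_isClosed_subset (isClosed_tsupport _)
    (tsupport_subset_of_mem hB f)) ((measure_mono (tsupport_subset_of_mem hB f)).trans_lt hfin)

variable (hB : IsCompact B) (hfin : surfaceMeasure Ω B < ∞)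

/-- Restriction to the boundary, from `C¹` functions vanishing off `B` to `L²(S)`. -/
def restrictL2 : c1SupportedIn B →ₗ[ℝ] L2 Ω where
  toFun f := (memLp_coe hB hfin f).toLp f
  map_add' f g := MemLp.toLp_add (memLp_coe hB hfin f) (memLp_coe hB hfin g)
  map_smul' c f := MemLp.toLp_const_smul c (memLp_coe hB hfin f)

/-- The tangential gradient, from `C¹` functions vanishing off `B` to square integrable fields. -/
def gradientL2 (hΩ : IsC2Admissible Ω) : c1SupportedIn B →ₗ[ℝ] L2Field Ω where
  toFun f := (memLp_tangentialGradient_coe hB hfin hΩ f).toLp _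
  map_add' f g := by
    rw [← MemLp.toLp_add]
    exact MemLp.toLp_congr _ _ (Eventually.of_forall
      (congrFun (tangentialGradient_add f.2.1 g.2.1)))
  map_smul' c f := by
    rw [RingHom.id_apply, ← MemLp.toLp_const_smul]
    exact MemLp.toLp_congr _ _ (Eventually.of_forall
      (congrFun (tangentialGradient_smul c f.2.1)))

lemma isWeakGradient_restrictL2 (hΩ : IsC2Admissible Ω) (f : c1SupportedIn B) :
    IsWeakGradient Ω (restrictL2 hB hfin f) (gradientL2 hB hfin hΩ f) :=
  isWeakGradient_toLp hΩ f.2.1 (memLp_coe hB hfin f) (memLp_tangentialGradient_coe hB hfin hΩ f)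

lemma coeFn_restrictL2 (f : c1SupportedIn B) :
    restrictL2 hB hfin f =ᵐ[surfaceMeasure Ω] (f : EuclideanSpace ℝ (Fin ν) → ℝ) :=
  (memLp_coe hB hfin f).coeFn_toLp

/-- Where the curvature is constantly `K_max`, the potential acts as a number. -/
lemma form_restrictL2 (hK : ∀ x ∈ frontier Ω ∩ B, curvature Ω x = curvatureMax Ω) (α : ℝ)
    (f : c1SupportedIn B) : form Ω α (restrictL2 hB hfin f) =
      dirichlet Ω (restrictL2 hB hfin f) -
        α * (curvatureMax Ω * ‖restrictL2 hB hfin f‖ ^ 2) := by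
  suffices h : ∫ x, curvature Ω x * restrictL2 hB hfin f x ^ 2 ∂surfaceMeasure Ω =
      ∫ x, curvatureMax Ω * restrictL2 hB hfin f x ^ 2 ∂surfaceMeasure Ω by
    rw [form, h, integral_const_mul, integral_sq_eq]
  refine integral_congr_ae ?_
  filter_upwards [ae_mem_frontier, coeFn_restrictL2 hB hfin f] with x hx hfx
  by_cases hxB : x ∈ B
  · rw [hK x ⟨hx, hxB⟩]
  · rw [hfx, f.2.2 x hxB]; ring

/-- Trial functions supported where the curvature is maximal bound the Rayleigh quotient from above,
with an error given by their Dirichlet integrals, independently of `α`. -/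
lemma exists_rayleigh_le (hΩ : IsC2Admissible Ω)
    (hK : ∀ x ∈ frontier Ω ∩ B, curvature Ω x = curvatureMax Ω) {j : ℕ}
    (f : Fin j → c1SupportedIn B) (hf : LinearIndependent ℝ fun i => restrictL2 hB hfin (f i)) :
    ∃ C : ℝ, 0 ≤ C ∧ ∀ α : ℝ, rayleigh Ω α j ≤ ((-α * curvatureMax Ω + C : ℝ) : EReal) := by
  let c := Fintype.linearCombination ℝ f
  let T : (Fin j → ℝ) →ₗ[ℝ] L2 Ω := restrictL2 hB hfin ∘ₗ c
  let D : (Fin j → ℝ) →ₗ[ℝ] L2Field Ω := gradientL2 hB hfin hΩ ∘ₗ c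
  have hT : LinearMap.ker T = ⊥ := by
    have h1 : T = Fintype.linearCombination ℝ fun i => restrictL2 hB hfin (f i) := by
      refine LinearMap.ext fun a => ?_
      simp [T, c, Fintype.linearCombination_apply]
    rw [h1, LinearMap.ker_eq_bot]
    exact hf.fintypeLinearCombination_injective
  obtain ⟨K, -, hTK⟩ := T.exists_antilipschitzWith hT
  have hTle : ∀ a, ‖a‖ ≤ K * ‖T a‖ := fun a => by
    simpa [dist_eq_norm] using hTK.le_mul_dist a 0
  have hDle : ∀ a, ‖D a‖ ≤ ‖LinearMap.toContinuousLinearMap D‖ * ‖a‖ :=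
    (LinearMap.toContinuousLinearMap D).le_opNorm
  refine ⟨(‖LinearMap.toContinuousLinearMap D‖ * K) ^ 2, sq_nonneg _, fun α => ?_⟩
  refine iInf_le_of_le (LinearMap.range T) (iInf_le_of_le ?_ (iInf_le_of_le ?_ ?_))
  · rintro _ ⟨a, rfl⟩
    exact ⟨_, isWeakGradient_restrictL2 hB hfin hΩ (c a)⟩
  · rw [LinearMap.finrank_range_of_inj (LinearMap.ker_eq_bot.1 hT), Module.finrank_fin_fun]
  · refine iSup_le fun u => iSup_le fun hu => iSup_le fun hu0 => ?_
    obtain ⟨a, rfl⟩ := hu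
    have hpos : 0 < ‖T a‖ ^ 2 := by positivity
    rw [EReal.coe_le_coe_iff, div_le_iff₀ hpos]
    have h1 : form Ω α (T a) = dirichlet Ω (T a) - α * (curvatureMax Ω * ‖T a‖ ^ 2) :=
      form_restrictL2 hB hfin hK α (c a)
    have h2 : dirichlet Ω (T a) ≤ ‖D a‖ ^ 2 :=
      dirichlet_le (isWeakGradient_restrictL2 hB hfin hΩ (c a))
    have h3 : ‖D a‖ ≤ ‖LinearMap.toContinuousLinearMap D‖ * K * ‖T a‖ := by
      refine (hDle a).trans ?_
      rw [mul_assoc]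
      exact mul_le_mul_of_nonneg_left (hTle a) (norm_nonneg _)
    have h4 : ‖D a‖ ^ 2 ≤ (‖LinearMap.toContinuousLinearMap D‖ * K * ‖T a‖) ^ 2 := by
      gcongr
    rw [mul_pow] at h4
    rw [h1]
    linarith

end Restriction

/-- Every ball centred on the boundary of a domain of dimension at least two contains infinitely
many boundary points, as finite sets have no area. -/
lemma infinite_frontier_inter_ball (hν : 2 ≤ ν) (hΩ : IsC2Admissible Ω) (hs : s ∈ frontier Ω)
    {r : ℝ} (hr : 0 < r) : (Metric.ball s r ∩ frontier Ω).Infinite := by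
  intro hfinite
  have hpos := surfaceMeasure_ball_pos (by omega) hΩ hs hr
  rw [surfaceMeasure, Measure.restrict_apply Metric.isOpen_ball.measurableSet] at hpos
  have := Measure.nullSingletonClass_hausdorff (EuclideanSpace ℝ (Fin ν)) (d := ((ν - 1 : ℕ) : ℝ))
    (by exact_mod_cast (by omega : 0 < ν - 1))
  refine hpos.ne' ?_
  rw [Measure.euclideanHausdorffMeasure_def, Measure.smul_apply, hfinite.measure_zero, smul_zero]

/-- There are arbitrarily many trial functions supported near a given boundary point: smooth bumps
with disjoint supports at distinct points of the boundary. -/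
lemma exists_linearIndependent_restrictL2 (hν : 2 ≤ ν) (hΩ : IsC2Admissible Ω)
    (hs : s ∈ frontier Ω) {r : ℝ} (hr : 0 < r)
    (hfin : surfaceMeasure Ω (Metric.closedBall s r) < ∞) (j : ℕ) :
    ∃ f : Fin j → c1SupportedIn (Metric.closedBall s r),
      LinearIndependent ℝ fun i => restrictL2 (isCompact_closedBall s r) hfin (f i) := by
  have hinf := infinite_frontier_inter_ball hν hΩ hs hr
  let p : Fin j → EuclideanSpace ℝ (Fin ν) := fun i => hinf.natEmbedding _ i
  have hp : ∀ i, p i ∈ Metric.ball s r ∩ frontier Ω := fun i => (hinf.natEmbedding _ i).2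
  have hpinj : Function.Injective p := fun i k h =>
    Fin.ext ((hinf.natEmbedding _).injective (Subtype.ext h))
  have hδ : ∀ᶠ δ in 𝓝[>] (0 : ℝ), (∀ i, δ + dist (p i) s ≤ r) ∧
      ∀ i k, i ≠ k → δ + δ ≤ dist (p i) (p k) := by
    refine Eventually.and (eventually_all.2 fun i => ?_)
      (eventually_all.2 fun i => eventually_all.2 fun k => ?_)
    · have h1 : 0 < r - dist (p i) s := sub_pos.2 (hp i).1
      filter_upwards [nhdsWithin_le_nhds (gt_mem_nhds h1)] with δ hδ
      linarith
    · rcases eq_or_ne i k with rfl | hik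
      · simp
      · have h1 : 0 < dist (p i) (p k) / 2 := half_pos (dist_pos.2 (hpinj.ne hik))
        filter_upwards [nhdsWithin_le_nhds (gt_mem_nhds h1)] with δ hδ _
        linarith
  obtain ⟨δ, ⟨hδr, hδd⟩, hδ0⟩ := (hδ.and self_mem_nhdsWithin).exists
  have hδ0' : 0 < δ := hδ0
  let b : ∀ i, ContDiffBump (p i) := fun i => ⟨δ / 2, δ, by positivity, by linarith⟩
  have hb0 : ∀ i, ∀ x, b i x ≠ 0 → dist x (p i) < δ := fun i x hx => by
    by_contra! hle
    exact hx ((b i).zero_of_le_dist hle)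
  let f : Fin j → c1SupportedIn (Metric.closedBall s r) := fun i =>
    ⟨b i, (b i).contDiff, fun x hx => by
      by_contra hne
      refine hx ?_
      have h1 := hb0 i x hne
      have h2 := dist_triangle x (p i) s
      have h3 := hδr i
      rw [Metric.mem_closedBall]
      linarith⟩
  refine ⟨f, linearIndependent_of_ne_zero_of_inner_eq_zero (fun i h0 => ?_) fun i k hik => ?_⟩
  · have h1 := coeFn_restrictL2 (isCompact_closedBall s r) hfin (f i)
    rw [h0] at h1
    have h2 : ∀ᵐ x ∂surfaceMeasure Ω, b i x = 0 := by
      filter_upwards [h1, Lp.coeFn_zero ℝ 2 (surfaceMeasure Ω)] with x hx hx0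
      exact hx.symm.trans hx0
    have h3 := surfaceMeasure_ball_pos (by omega) hΩ (hp i).2 (half_pos hδ0')
    refine h3.ne' (measure_mono_null (fun x hx => ?_) (ae_iff.1 h2))
    have h4 : b i x = 1 := (b i).one_of_mem_closedBall (Metric.ball_subset_closedBall hx)
    simp [h4]
  · change ⟪restrictL2 _ hfin (f i), restrictL2 _ hfin (f k)⟫ = 0
    rw [MeasureTheory.L2.inner_def]
    refine integral_eq_zero_of_ae ?_
    filter_upwards [coeFn_restrictL2 (isCompact_closedBall s r) hfin (f i),
      coeFn_restrictL2 (isCompact_closedBall s r) hfin (f k)] with x hxi hxk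
    rw [hxi, hxk]
    by_cases h1 : b i x = 0
    · simp [f, h1]
    · have h2 : b k x = 0 := by
        by_contra h2
        have h3 := hb0 i x h1
        have h4 := hb0 k x h2
        have h5 := dist_triangle_left (p i) (p k) x
        linarith [hδd i k hik]
      simp [f, h2]

end RobinBoundary

end

theorem mainTheorem11 {ν : ℕ} (hν : 2 ≤ ν) (Ω : Set (EuclideanSpace ℝ (Fin ν)))
    (hΩ : RobinBoundary.IsC2Admissible Ω)
    (hK : (interior {s : frontier Ω |
      RobinBoundary.curvature Ω s = RobinBoundary.curvatureMax Ω}).Nonempty)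
    (j : ℕ) (hj : 1 ≤ j) :
    ∃ C : ℝ, ∀ᶠ α : ℝ in Filter.atTop,
      ((-α * RobinBoundary.curvatureMax Ω - C : ℝ) : EReal) ≤ RobinBoundary.rayleigh Ω α j ∧
      RobinBoundary.rayleigh Ω α j ≤ ((-α * RobinBoundary.curvatureMax Ω + C : ℝ) : EReal) := by
  obtain ⟨⟨s, hs⟩, hsK⟩ := hK
  obtain ⟨ε, hε, hball⟩ := Metric.mem_nhds_iff.1 (mem_interior_iff_mem_nhds.1 hsK)
  obtain ⟨r₀, hr₀, hfin₀⟩ :=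
    RobinBoundary.exists_surfaceMeasure_ball_lt_top (by omega) hΩ hs
  have hr : 0 < min ε r₀ / 2 := by positivity
  have hlt : min ε r₀ / 2 < min ε r₀ := by linarith
  have hfin : RobinBoundary.surfaceMeasure Ω (Metric.closedBall s (min ε r₀ / 2)) < ⊤ :=
    (measure_mono (Metric.closedBall_subset_ball
      (hlt.trans_le (min_le_right _ _)))).trans_lt hfin₀
  obtain ⟨f, hf⟩ := RobinBoundary.exists_linearIndependent_restrictL2 hν hΩ hs hr hfin j
  have hKB : ∀ x ∈ frontier Ω ∩ Metric.closedBall s (min ε r₀ / 2),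
      RobinBoundary.curvature Ω x = RobinBoundary.curvatureMax Ω := by
    intro x hx
    have hxε : dist x s < ε :=
      (Metric.mem_closedBall.1 hx.2).trans_lt (hlt.trans_le (min_le_left _ _))
    have hmem : (⟨x, hx.1⟩ : frontier Ω) ∈ Metric.ball (⟨s, hs⟩ : frontier Ω) ε := by
      rwa [Metric.mem_ball, Subtype.dist_eq]
    have h := hball hmem
    rwa [mem_ofPred_eq] at h
  obtain ⟨C, hC0, hC⟩ :=
    RobinBoundary.exists_rayleigh_le (isCompact_closedBall s _) hfin hΩ hKB f hf
  refine ⟨C, ?_⟩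
  filter_upwards [eventually_ge_atTop (0 : ℝ)] with α hα
  refine ⟨le_trans ?_ (RobinBoundary.le_rayleigh hΩ hα hj), hC α⟩
  rw [EReal.coe_le_coe_iff]
  linarith
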